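/- Let $S^d\mathbb{C}^2\subseteq(\mathbb{C}^2)^{\otimes d}$ denote the space of symmetric tensors, identified with binary forms of degree $d$. For $T\in S^{d_1}\mathbb{C}^2\otimes\cdots\otimes S^{d_k}\mathbb{C}^2$, the partially symmetric rank $R_{d_1,\dots,d_k}(T)$ is the least $r$ such that $T=\sum_{i=1}^r v_{i,1}^{\otimes d_1}\otimes\cdots\otimes v_{i,k}^{\otimes d_k}$ for some $v_{i,j}\in\mathbb{C}^2$. Fix a basis $\{x,y\}$ of $\mathbb{C}^2$ and let $W_d = y\otimes x\otimes\cdots\otimes x + x\otimes y\otimes x\otimes\cdots\otimes x+\cdots+x\otimes\cdots\otimes x\otimes y\in S^d\mathbb{C}^2$ (up to a nonzero scalar, the form $x^{d-1}y$). Then for every integer $d\ge 2$: (1) $R_{2,d}(W_2\otimes W_d)=2d$. Moreover $R_2(W_2)=2$ and $R_d(W_d)=d$, so the rank is multiplicative here: $R_{2,d}(W_2\otimes W_d)=R_2(W_2)\,R_d(W_d)$. (2) Every $q\in S^2\mathbb{C}^2$ that is not of the form $v\otimes v$ with $v\in\mathbb{C}^2$ (that is, every nondegenerate quadratic form) is equivalent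 to $W_2$ under the action of $GL_2(\mathbb{C})$, and satisfies $R_2(q)=2$ and $R_{2,d}(q\otimes W_d)=2d$. In particular $R_2(x\otimes x+y\otimes y)=2$ and $R_{2,d}((x\otimes x+y\otimes y)\otimes W_d)=2d$, where $x\otimes x+y\otimes y$ is the quadratic form $x^2+y^2$. -/

import Mathlib

open scoped TensorProduct

noncomputable section

namespace PartSym

/-- The space `ℂ²`. -/
abbrev C2 : Type := Fin 2 → ℂ

/-- `S^d ℂ²`: the subspace of symmetric tensors in `(ℂ²)^{⊗ d}`, i.e. of the tensors fixed by all
permutations of the `d` tensor factors. -/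
def SymTensor (d : ℕ) : Submodule ℂ (⨂[ℂ]^d C2) where
  carrier := {t | ∀ σ : Equiv.Perm (Fin d), PiTensorProduct.reindex ℂ (fun _ => C2) σ t = t}
  add_mem' := by
    intro a b ha hb σ
    rw [map_add, ha σ, hb σ]
  zero_mem' := by
    intro σ
    rw [map_zero]
  smul_mem' := by
    intro c a ha σ
    rw [map_smul, ha σ]

/-- The power `v^{⊗ d}`, as an element of `S^d ℂ²`. -/
def power (d : ℕ) (v : C2) : SymTensor d :=
  ⟨PiTensorProduct.tprod ℂ (fun _ : Fin d => v), by
    intro σ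
    rw [PiTensorProduct.reindex_tprod]⟩

/-- The `W`-state
`W_d = y ⊗ x ⊗ ⋯ ⊗ x + x ⊗ y ⊗ x ⊗ ⋯ ⊗ x + ⋯ + x ⊗ ⋯ ⊗ x ⊗ y` in `S^d ℂ²`. -/
def W (x y : C2) (d : ℕ) : SymTensor d :=
  ⟨∑ i : Fin d, PiTensorProduct.tprod ℂ (Function.update (fun _ : Fin d => x) i y), by
    intro σ
    rw [map_sum, ← Equiv.sum_comp σ (fun i : Fin d =>
      PiTensorProduct.tprod ℂ (Function.update (fun _ : Fin d => x) i y))]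
    refine Finset.sum_congr rfl fun i _ => ?_
    rw [PiTensorProduct.reindex_tprod]
    congr 1
    funext j
    by_cases h : j = σ i
    · subst h
      simp
    · have h' : σ.symm j ≠ i := fun e => h (by rw [← e, Equiv.apply_symm_apply])
      rw [Function.update_of_ne h', Function.update_of_ne h]⟩

/-- The symmetric rank `R_d(T)` of `T ∈ S^d ℂ²`: the least `r` such that
`T = ∑_{i=1}^r v_i^{⊗ d}` for some `v_i ∈ ℂ²`. -/
def rank₁ (d : ℕ) (T : SymTensor d) : ℕ :=
  sInf {r : ℕ | ∃ v : Fin r → C2, T = ∑ i, power d (v i)}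

/-- The partially symmetric rank `R_{d₁,d₂}(T)` of `T ∈ S^{d₁} ℂ² ⊗ S^{d₂} ℂ²`: the least `r` such
that `T = ∑_{i=1}^r v_i^{⊗ d₁} ⊗ w_i^{⊗ d₂}` for some `v_i, w_i ∈ ℂ²`. -/
def rank₂ (d₁ d₂ : ℕ) (T : SymTensor d₁ ⊗[ℂ] SymTensor d₂) : ℕ :=
  sInf {r : ℕ | ∃ v w : Fin r → C2, T = ∑ i, power d₁ (v i) ⊗ₜ[ℂ] power d₂ (w i)}

end PartSym

end

open scoped TensorProduct

namespace PartSym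

/-! The lower bound is an apolarity argument. Let α, β be the coordinates dual to x, y. Contracting
`q ⊗ W_d` with `l l' ⊗ α^{d-k} β^k` gives 0 unless k = 1, when it gives the polar form `B(l, l')` of
q. With r < 2d summands, some nonzero form `∑ α^{d-1-k} β^k g_k` of bidegree (1, d-1) vanishes at
every point. If `g_m` is its first nonzero coefficient, replacing the factor `β^m` by `α^m β` keeps
it vanishing there. Contracting with this new form times any l' leaves `B(g_m, l') = 0`, so `g_m =
0` by nondegeneracy (`two_mul_le_of_moments`).

For the upper bound, averaging over d-th roots of unity writes `W_d` as d powers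
(`exists_W_eq_sum_power`). Over ℂ every q is a product of two linear forms (`exists_eq_W_two`),
independent when q is not a square, so every such q is handled like `W_2`. -/

/-- The linear form on `(ℂ²)^{⊗ d}` given by a product of linear forms on `ℂ²`. -/
noncomputable def prodForm {d : ℕ} (l : Fin d → Module.Dual ℂ C2) : (⨂[ℂ]^d C2) →ₗ[ℂ] ℂ :=
  PiTensorProduct.lift ((MultilinearMap.mkPiAlgebra ℂ (Fin d) ℂ).compLinearMap l)

theorem prodForm_tprod {d : ℕ} (l : Fin d → Module.Dual ℂ C2) (f : Fin d → C2) :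
    prodForm l (PiTensorProduct.tprod ℂ f) = ∏ i, l i (f i) := by
  simp [prodForm]

/-! ### Binary quadratic forms as products `W u w 2` -/

theorem W_two_coe (u w : C2) : (W u w 2 : ⨂[ℂ]^2 C2) =
    PiTensorProduct.tprod ℂ ![w, u] + PiTensorProduct.tprod ℂ ![u, w] := by
  change (∑ i : Fin 2, PiTensorProduct.tprod ℂ (Function.update (fun _ : Fin 2 => u) i w)) = _
  rw [Fin.sum_univ_two]
  congr 2 <;> (funext i; fin_cases i <;> simp)

theorem W_two_comm (u w : C2) : W u w 2 = W w u 2 := by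
  apply Subtype.ext
  rw [W_two_coe, W_two_coe, add_comm]

theorem W_two_add_left (u u' w : C2) : W (u + u') w 2 = W u w 2 + W u' w 2 := by
  apply Subtype.ext
  rw [Submodule.coe_add, W_two_coe, W_two_coe, W_two_coe]
  have h1 := (PiTensorProduct.tprod ℂ (s := fun _ : Fin 2 => C2)).map_update_add ![w, u] 1 u u'
  have h2 := (PiTensorProduct.tprod ℂ (s := fun _ : Fin 2 => C2)).map_update_add ![u, w] 0 u u'
  have e1 (z : C2) : Function.update ![w, u] 1 z = ![w, z] := by
    funext i; fin_cases i <;> simp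
  have e2 (z : C2) : Function.update ![u, w] 0 z = ![z, w] := by
    funext i; fin_cases i <;> simp
  rw [e1, e1, e1] at h1
  rw [e2, e2, e2] at h2
  rw [h1, h2]
  abel

theorem W_two_smul_left (c : ℂ) (u w : C2) : W (c • u) w 2 = c • W u w 2 := by
  apply Subtype.ext
  rw [Submodule.coe_smul, W_two_coe, W_two_coe]
  have h1 := (PiTensorProduct.tprod ℂ (s := fun _ : Fin 2 => C2)).map_update_smul ![w, u] 1 c u
  have h2 := (PiTensorProduct.tprod ℂ (s := fun _ : Fin 2 => C2)).map_update_smul ![u, w] 0 c u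
  have e1 (z : C2) : Function.update ![w, u] 1 z = ![w, z] := by
    funext i; fin_cases i <;> simp
  have e2 (z : C2) : Function.update ![u, w] 0 z = ![z, w] := by
    funext i; fin_cases i <;> simp
  rw [e1, e1] at h1
  rw [e2, e2] at h2
  rw [h1, h2, smul_add]

theorem W_two_add_right (u w w' : C2) : W u (w + w') 2 = W u w 2 + W u w' 2 := by
  rw [W_two_comm, W_two_add_left, W_two_comm w, W_two_comm w']

theorem W_two_smul_right (c : ℂ) (u w : C2) : W u (c • w) 2 = c • W u w 2 := by
  rw [W_two_comm, W_two_smul_left, W_two_comm]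

theorem W_two_self (v : C2) : W v v 2 = (2 : ℂ) • power 2 v := by
  apply Subtype.ext
  rw [Submodule.coe_smul, W_two_coe, two_smul]
  have : ![v, v] = fun _ : Fin 2 => v := by funext i; fin_cases i <;> simp
  rw [this]
  rfl

/-- A d-th root of c is absorbed into v; this is why unweighted sums of powers suffice. -/
theorem smul_power_eq {d : ℕ} (hd : 0 < d) (c : ℂ) (v : C2) :
    ∃ v', c • power d v = power d v' := by
  obtain ⟨z, hz⟩ := IsAlgClosed.exists_pow_nat_eq c hd
  refine ⟨z • v, Subtype.ext ?_⟩
  have := (PiTensorProduct.tprod ℂ (s := fun _ : Fin d => C2)).map_smul_univ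
    (fun _ => z) (fun _ => v)
  rw [Finset.prod_const, Finset.card_univ, Fintype.card_fin, hz] at this
  exact this.symm

theorem exists_add_mul (p q : ℂ) : ∃ r s : ℂ, r + s = p ∧ r * s = q := by
  obtain ⟨z, hz⟩ := IsAlgClosed.exists_pow_nat_eq (p ^ 2 - 4 * q) (n := 2) (by norm_num)
  refine ⟨(p + z) / 2, (p - z) / 2, by ring, ?_⟩
  linear_combination (-1 / 4) * hz

/-- A binary quadratic form factors into linear forms. -/
theorem exists_eq_W_two (b : Module.Basis (Fin 2) ℂ C2) (q : SymTensor 2) :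
    ∃ u w, q = W u w 2 := by
  -- Symmetrizing `f 0 ⊗ f 1` gives `W (f 0) (f 1) 2`; on a symmetric q, symmetrizing is doubling.
  have key : ∀ t : ⨂[ℂ]^2 C2, ∃ A B C : ℂ,
      t + PiTensorProduct.reindex ℂ (fun _ => C2) (Equiv.swap (0 : Fin 2) 1) t =
        ((A • W (b 0) (b 0) 2 + B • W (b 0) (b 1) 2 + C • W (b 1) (b 1) 2 : SymTensor 2) :
          ⨂[ℂ]^2 C2) := by
    intro t
    induction t using PiTensorProduct.induction_on with
    | smul_tprod r f =>
      have e : r • PiTensorProduct.tprod ℂ f + PiTensorProduct.reindex ℂ (fun _ => C2)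
          (Equiv.swap (0 : Fin 2) 1) (r • PiTensorProduct.tprod ℂ f) =
          ((r • W (f 0) (f 1) 2 : SymTensor 2) : ⨂[ℂ]^2 C2) := by
        rw [map_smul, PiTensorProduct.reindex_tprod, Submodule.coe_smul, W_two_coe, smul_add,
          add_comm]
        congr 3
        · funext i
          fin_cases i
          · exact congrArg f (Equiv.swap_apply_left 0 1)
          · exact congrArg f (Equiv.swap_apply_right 0 1)
        · funext i
          fin_cases i <;> simp
      rw [e, ← b.sum_repr (f 0), ← b.sum_repr (f 1), Fin.sum_univ_two, Fin.sum_univ_two]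
      generalize b.repr (f 0) 0 = p
      generalize b.repr (f 0) 1 = p'
      generalize b.repr (f 1) 0 = s
      generalize b.repr (f 1) 1 = s'
      refine ⟨r * p * s, r * (p * s' + p' * s), r * p' * s', congrArg _ ?_⟩
      simp only [W_two_add_left, W_two_add_right, W_two_smul_left, W_two_smul_right,
        W_two_comm (b 1) (b 0)]
      module
    | add t t' h h' =>
      obtain ⟨A, B, C, h⟩ := h
      obtain ⟨A', B', C', h'⟩ := h'
      refine ⟨A + A', B + B', C + C', ?_⟩
      rw [map_add, add_add_add_comm, h, h', ← Submodule.coe_add]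
      congr 1
      module
  obtain ⟨A, B, C, h⟩ := key q
  rw [q.2 (Equiv.swap 0 1), ← Submodule.coe_add] at h
  have h2 : q + q = A • W (b 0) (b 0) 2 + B • W (b 0) (b 1) 2 + C • W (b 1) (b 1) 2 :=
    Subtype.ext h
  have h3 : q = (1 / 2 : ℂ) • (q + q) := by module
  rw [h3, h2]
  -- If A = 0, `b 1` divides the form. Otherwise A is factored out and the monic quadratic is split.
  by_cases hA : A = 0
  · refine ⟨(1 / 2 : ℂ) • (B • b 0 + C • b 1), b 1, ?_⟩
    simp only [W_two_add_left, W_two_smul_left, hA]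
    module
  · obtain ⟨r, s, hs, hp⟩ := exists_add_mul (B / A) (C / A)
    refine ⟨(A / 2) • (b 0 + r • b 1), b 0 + s • b 1, ?_⟩
    have hB : B = A * (r + s) := by rw [hs]; field_simp
    have hC : C = A * (r * s) := by rw [hp]; field_simp
    simp only [W_two_add_left, W_two_add_right, W_two_smul_left, W_two_smul_right,
      W_two_comm (b 1) (b 0), hB, hC]
    module

/-- Proportional factors would make the product a multiple of a square, hence a square over ℂ. -/
theorem linearIndependent_of_W_two_ne_power {u w : C2} (h : ∀ v, W u w 2 ≠ power 2 v) :
    LinearIndependent ℂ ![u, w] := by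
  rw [LinearIndependent.pair_iff' (fun hu => ?_)]
  · rintro c rfl
    obtain ⟨v', hv'⟩ := smul_power_eq (d := 2) (by norm_num) (c * 2) u
    apply h v'
    rw [W_two_smul_right, W_two_self, smul_smul, hv']
  · obtain ⟨v', hv'⟩ := smul_power_eq (d := 2) (by norm_num) 0 u
    apply h v'
    rw [← hv', zero_smul, hu, ← zero_smul ℂ (0 : C2), W_two_smul_left, zero_smul]

theorem prodForm_W_two (l l' : Module.Dual ℂ C2) (u w : C2) :
    prodForm ![l, l'] (W u w 2) = l w * l' u + l u * l' w := by
  rw [W_two_coe, map_add, prodForm_tprod, prodForm_tprod]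
  simp

theorem prodForm_power_two (l l' : Module.Dual ℂ C2) (v : C2) :
    prodForm ![l, l'] (power 2 v) = l v * l' v := by
  change prodForm ![l, l'] (PiTensorProduct.tprod ℂ (fun _ => v)) = _
  rw [prodForm_tprod]
  simp

theorem W_two_ne_power (b : Module.Basis (Fin 2) ℂ C2) (v : C2) :
    W (b 0) (b 1) 2 ≠ power 2 v := by
  intro h
  have e (l l' : Module.Dual ℂ C2) := congrArg (fun t : SymTensor 2 => prodForm ![l, l'] t) h
  simp only [prodForm_W_two, prodForm_power_two] at e
  have h00 := e (b.coord 0) (b.coord 0)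
  have h01 := e (b.coord 0) (b.coord 1)
  simp at h00 h01
  simp [h00] at h01

theorem power_add_power_ne_power (b : Module.Basis (Fin 2) ℂ C2) (v : C2) :
    power 2 (b 0) + power 2 (b 1) ≠ power 2 v := by
  intro h
  have e (l l' : Module.Dual ℂ C2) := congrArg (fun t : SymTensor 2 => prodForm ![l, l'] t) h
  simp only [Submodule.coe_add, map_add, prodForm_power_two] at e
  have h00 := e (b.coord 0) (b.coord 0)
  have h01 := e (b.coord 0) (b.coord 1)
  have h11 := e (b.coord 1) (b.coord 1)
  simp at h00 h01 h11
  rcases h01 with h | h <;> simp_all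

/-! ### Contractions and the lower bound -/

/-- The monomial of degree `k` in `β` and `d - k` in `α`. -/
noncomputable def monomialForm (d k : ℕ) (α β : Module.Dual ℂ C2) : SymTensor d →ₗ[ℂ] ℂ :=
  prodForm (fun i : Fin d => if (i : ℕ) < k then β else α) ∘ₗ (SymTensor d).subtype

theorem monomialForm_power {d k : ℕ} (hk : k ≤ d) (α β : Module.Dual ℂ C2) (v : C2) :
    monomialForm d k α β (power d v) = α v ^ (d - k) * β v ^ k := by
  change prodForm _ (PiTensorProduct.tprod ℂ (fun _ => v)) = _
  rw [prodForm_tprod]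
  simp only [apply_ite (fun l : Module.Dual ℂ C2 => l v)]
  rw [Fin.prod_univ_eq_prod_range (fun i => if i < k then β v else α v) d,
    ← Finset.prod_range_mul_prod_Ico _ hk, mul_comm]
  congr 1
  · rw [Finset.prod_congr rfl (g := fun _ => α v)]
    · simp
    · intro i hi
      simp only [Finset.mem_Ico] at hi
      simp [hi.1]
  · rw [Finset.prod_congr rfl (g := fun _ => β v)]
    · simp
    · intro i hi
      simp only [Finset.mem_range] at hi
      simp [hi]

/-- As β kills `b 0` and α kills `b 1`, a summand survives only if the β-slots are exactly the slot
holding `b 1`. -/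
theorem monomialForm_W {d : ℕ} (hd : 2 ≤ d) {k : ℕ} (hk : k ≤ d)
    (b : Module.Basis (Fin 2) ℂ C2) :
    monomialForm d k (b.coord 0) (b.coord 1) (W (b 0) (b 1) d) = if k = 1 then 1 else 0 := by
  change prodForm _ (∑ i : Fin d, PiTensorProduct.tprod ℂ
    (Function.update (fun _ : Fin d => b 0) i (b 1))) = _
  rw [map_sum]
  simp only [prodForm_tprod]
  have hterm (i : Fin d) : (∏ j : Fin d, (if (j : ℕ) < k then b.coord 1 else b.coord 0)
      (Function.update (fun _ : Fin d => b 0) i (b 1) j)) =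
      if k = 1 ∧ i = ⟨0, by omega⟩ then 1 else 0 := by
    split_ifs with h
    · obtain ⟨rfl, rfl⟩ := h
      refine Finset.prod_eq_one fun j _ => ?_
      by_cases hj : j = ⟨0, by omega⟩
      · subst hj; simp
      · have : ¬ (j : ℕ) < 1 := fun h => hj (Fin.ext (by simpa using h))
        simp [Function.update_of_ne hj, this]
    · by_cases hik : (i : ℕ) < k
      · have : ∃ j : Fin d, j ≠ i ∧ (j : ℕ) < k := by
          by_cases hi : (i : ℕ) = 0
          · have hk1 : k ≠ 1 := fun hk1 => h ⟨hk1, Fin.ext hi⟩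
            exact ⟨⟨1, by omega⟩, fun e => by simp [← e] at hi, by simp; omega⟩
          · exact ⟨⟨0, by omega⟩, fun e => hi (by simp [← e]), by simp; omega⟩
        obtain ⟨j, hji, hj⟩ := this
        refine Finset.prod_eq_zero (Finset.mem_univ j) ?_
        simp [Function.update_of_ne hji, hj]
      · refine Finset.prod_eq_zero (Finset.mem_univ i) ?_
        simp [hik]
  simp only [hterm]
  by_cases hk1 : k = 1 <;> simp [hk1]

/-- Fewer than `2 d` points of `ℙ¹ × ℙ¹` lie on a nonzero form of bidegree `(1, d - 1)`. -/
theorem exists_form_vanishing {d r : ℕ} (hr : r < 2 * d) (v : Fin r → C2) (α β : Fin r → ℂ) :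
    ∃ g : Fin d → Module.Dual ℂ C2, g ≠ 0 ∧
      ∀ i, ∑ k : Fin d, α i ^ (d - 1 - k) * β i ^ (k : ℕ) * g k (v i) = 0 := by
  let L : (Fin d → Module.Dual ℂ C2) →ₗ[ℂ] (Fin r → ℂ) :=
    LinearMap.pi fun i => ∑ k : Fin d, (α i ^ (d - 1 - (k : ℕ)) * β i ^ (k : ℕ)) •
      ((Module.Dual.eval ℂ C2 (v i)) ∘ₗ LinearMap.proj k)
  have hlt : Module.finrank ℂ (Fin r → ℂ) < Module.finrank ℂ (Fin d → Module.Dual ℂ C2) := by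
    rw [Module.finrank_fin_fun, Module.finrank_pi_fintype]
    simp only [Subspace.dual_finrank_eq, Module.finrank_fin_fun, Finset.sum_const,
      Finset.card_univ, Fintype.card_fin, smul_eq_mul]
    omega
  obtain ⟨g, hg, hg0⟩ := L.ker.exists_mem_ne_zero_of_ne_bot
    (LinearMap.ker_ne_bot_of_finrank_lt hlt)
  refine ⟨g, hg0, fun i => ?_⟩
  have := congrFun (LinearMap.mem_ker.mp hg) i
  simpa [L] using this

/-- The contraction argument behind the lower bound: a bidegree `(1, d - 1)` form vanishing at the
points, divided by the largest possible power of `β`, annihilates the quadratic form `B`. -/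
theorem two_mul_le_of_moments {d r : ℕ} (v : Fin r → C2) (α β : Fin r → ℂ)
    (B : Module.Dual ℂ C2 → Module.Dual ℂ C2 → ℂ)
    (hB : ∀ l, (∀ l', B l l' = 0) → l = 0)
    (h : ∀ k ≤ d, ∀ l l', ∑ i, α i ^ (d - k) * β i ^ k * (l (v i) * l' (v i)) =
      if k = 1 then B l l' else 0) :
    2 * d ≤ r := by
  by_contra! hr
  obtain ⟨g, hg0, hg⟩ := exists_form_vanishing hr v α β
  let G : ℕ → Module.Dual ℂ C2 := fun k => if hk : k < d then g ⟨k, hk⟩ else 0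
  have hGg (k : Fin d) : G k = g k := by simp [G]
  have hG : ∀ i, ∑ k ∈ Finset.range d, α i ^ (d - 1 - k) * β i ^ k * G k (v i) = 0 := by
    intro i
    rw [← hg i, ← Fin.sum_univ_eq_sum_range
      (fun k => α i ^ (d - 1 - k) * β i ^ k * G k (v i)) d]
    simp only [hGg]
  have hex : ∃ k, G k ≠ 0 := by
    obtain ⟨k, hk⟩ := Function.ne_iff.mp hg0
    exact ⟨k, by rwa [hGg]⟩
  classical
  let m := Nat.find hex
  have hm : G m ≠ 0 := Nat.find_spec hex
  have hlt : ∀ k < m, G k = 0 := fun k hk => not_not.mp (Nat.find_min hex hk)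
  have hmd : m < d := by
    by_contra hmd
    exact hm (by simp [G, hmd])
  -- The extra factor β covers the points with `β i = 0`; elsewhere `β i ^ m` can be cancelled.
  have hF : ∀ i, ∑ k ∈ Finset.range (d - m),
      α i ^ (d - (k + 1)) * β i ^ (k + 1) * G (m + k) (v i) = 0 := by
    intro i
    by_cases hb : β i = 0
    · simp [hb]
    have h1 := hG i
    rw [← Finset.sum_range_add_sum_Ico _ hmd.le, Finset.sum_eq_zero, zero_add,
      Finset.sum_Ico_eq_sum_range] at h1
    · have h2 : β i ^ m * (∑ k ∈ Finset.range (d - m),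
          α i ^ (d - (k + 1)) * β i ^ (k + 1) * G (m + k) (v i)) = 0 := by
        rw [← mul_zero (α i ^ m * β i), ← h1, Finset.mul_sum, Finset.mul_sum]
        refine Finset.sum_congr rfl fun k hk => ?_
        rw [Finset.mem_range] at hk
        have : d - (k + 1) = m + (d - 1 - (m + k)) := by omega
        rw [this]
        ring
      exact (mul_eq_zero.mp h2).resolve_left (pow_ne_zero _ hb)
    · intro k hk
      simp [hlt k (Finset.mem_range.mp hk)]
  refine hm (hB _ fun l' => ?_)
  have h1 : ∑ k ∈ Finset.range (d - m), ∑ i,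
      α i ^ (d - (k + 1)) * β i ^ (k + 1) * (G (m + k) (v i) * l' (v i)) = 0 := by
    rw [Finset.sum_comm]
    refine Finset.sum_eq_zero fun i _ => ?_
    simp only [← mul_assoc]
    rw [← Finset.sum_mul, hF i, zero_mul]
  rw [Finset.sum_congr rfl (g := fun k => if k = 0 then B (G m) l' else 0)] at h1
  · simpa [hmd] using h1
  · intro k hk
    rw [Finset.mem_range] at hk
    rw [h (k + 1) (by omega)]
    by_cases hk0 : k = 0 <;> simp [hk0]

theorem two_mul_le_of_decomposition {d : ℕ} (hd : 2 ≤ d) (b : Module.Basis (Fin 2) ℂ C2)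
    {u w : C2} (huw : LinearIndependent ℂ ![u, w]) {r : ℕ} (v z : Fin r → C2)
    (h : W u w 2 ⊗ₜ[ℂ] W (b 0) (b 1) d = ∑ i, power 2 (v i) ⊗ₜ[ℂ] power d (z i)) :
    2 * d ≤ r := by
  let c : Module.Basis (Fin 2) ℂ C2 :=
    basisOfLinearIndependentOfCardEqFinrank huw (by simp)
  have hc0 : c 0 = u := by simp [c]
  have hc1 : c 1 = w := by simp [c]
  refine two_mul_le_of_moments v (fun i => b.coord 0 (z i)) (fun i => b.coord 1 (z i))
    (fun l l' => l w * l' u + l u * l' w) ?_ ?_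
  · intro l hl
    refine c.ext fun i => ?_
    -- Pairing with the coordinate of u isolates `l w`, and conversely.
    have h0 := hl (c.coord 0)
    have h1 := hl (c.coord 1)
    rw [← hc0, ← hc1] at h0 h1
    fin_cases i
    · simpa using h1
    · simpa using h0
  · intro k hk l l'
    have e := congrArg (TensorProduct.lift ((LinearMap.mul ℂ ℂ).compl₁₂
      (prodForm ![l, l'] ∘ₗ (SymTensor 2).subtype)
      (monomialForm d k (b.coord 0) (b.coord 1)))) h
    simp only [map_sum, TensorProduct.lift.tmul, LinearMap.compl₁₂_apply, LinearMap.comp_apply,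
      Submodule.subtype_apply, LinearMap.mul_apply', prodForm_W_two, prodForm_power_two,
      monomialForm_W hd hk, monomialForm_power hk] at e
    rw [Finset.sum_congr rfl fun i _ => mul_comm _ _, ← e]
    simp

/-! ### Decompositions into powers -/

theorem power_add_smul_coe (d : ℕ) (x y : C2) (c : ℂ) :
    (power d (x + c • y) : ⨂[ℂ]^d C2) = ∑ s : Finset (Fin d),
      c ^ s.card • PiTensorProduct.tprod ℂ (s.piecewise (fun _ => y) (fun _ => x)) := by
  change PiTensorProduct.tprod ℂ (fun _ => x + c • y) = _
  have h := (PiTensorProduct.tprod ℂ (s := fun _ : Fin d => C2)).map_add_univ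
    (fun _ => c • y) (fun _ => x)
  have e : (fun _ : Fin d => x + c • y) = (fun _ : Fin d => c • y) + fun _ => x := by
    funext i; simp [add_comm]
  rw [e, h]
  refine Finset.sum_congr rfl fun s _ => ?_
  have h2 := (PiTensorProduct.tprod ℂ (s := fun _ : Fin d => C2)).map_piecewise_smul
    (fun _ => c) (s.piecewise (fun _ => y) (fun _ => x)) s
  rw [Finset.prod_const] at h2
  rw [← h2]
  congr 1
  funext i
  by_cases hi : i ∈ s <;> simp [hi]

/-- The form `x^{d-1} y` is a sum of `d` powers. -/
theorem exists_W_eq_sum_power {d : ℕ} (hd : 2 ≤ d) (x y : C2) :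
    ∃ v : Fin d → C2, W x y d = ∑ i, power d (v i) := by
  have hd0 : d ≠ 0 := by omega
  have hζ := Complex.isPrimitiveRoot_exp d hd0
  set ζ := Complex.exp (2 * Real.pi * Complex.I / d)
  have hsum (n : ℕ) (hn : n ≤ d) :
      ∑ j ∈ Finset.range d, (ζ ^ j) ^ (d - 1) * (ζ ^ j) ^ n = if n = 1 then (d : ℂ) else 0 := by
    have e (j : ℕ) : (ζ ^ j) ^ (d - 1) * (ζ ^ j) ^ n = (ζ ^ (d - 1 + n)) ^ j := by
      rw [← pow_add, ← pow_mul, ← pow_mul, mul_comm]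
    simp only [e]
    split_ifs with h1
    · subst h1
      rw [Nat.sub_add_cancel (by omega), hζ.pow_eq_one]
      simp
    · have hne : ζ ^ (d - 1 + n) ≠ 1 := by
        rw [Ne, hζ.pow_eq_one_iff_dvd]
        rintro ⟨c, hc⟩
        have : c = 1 := by
          have hc0 : 0 < c := by
            rcases Nat.eq_zero_or_pos c with rfl | h
            · omega
            · exact h
          by_contra hc1
          have : d * 2 ≤ d * c := Nat.mul_le_mul_left _ (by omega)
          omega
        subst this
        omega
      rw [geom_sum_eq hne, ← pow_mul, mul_comm, pow_mul, hζ.pow_eq_one]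
      simp
  have hW : W x y d = ∑ j : Fin d,
      ((d : ℂ)⁻¹ * (ζ ^ (j : ℕ)) ^ (d - 1)) • power d (x + ζ ^ (j : ℕ) • y) := by
    apply Subtype.ext
    rw [Submodule.coe_sum]
    change ∑ i : Fin d, PiTensorProduct.tprod ℂ (Function.update (fun _ : Fin d => x) i y) = _
    simp only [Submodule.coe_smul, power_add_smul_coe, Finset.smul_sum, smul_smul]
    rw [Finset.sum_comm]
    simp only [← Finset.sum_smul, mul_assoc, ← Finset.mul_sum]
    have hs (s : Finset (Fin d)) := Fin.sum_univ_eq_sum_range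
      (fun j => (ζ ^ j) ^ (d - 1) * (ζ ^ j) ^ s.card) d
    simp only [hs]
    have hs' (s : Finset (Fin d)) := hsum s.card (by simpa using s.card_le_univ)
    simp only [hs', mul_ite, mul_zero, ite_smul, zero_smul,
      inv_mul_cancel₀ (Nat.cast_ne_zero (R := ℂ).mpr hd0), one_smul]
    rw [← Finset.sum_filter]
    have hf : (Finset.univ.filter fun s : Finset (Fin d) => s.card = 1) =
        Finset.univ.map ⟨fun i : Fin d => ({i} : Finset (Fin d)), Finset.singleton_injective⟩ := by
      ext s
      simp [Finset.card_eq_one, eq_comm]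
    rw [hf, Finset.sum_map]
    refine Finset.sum_congr rfl fun i _ => ?_
    congr 1
    funext j
    by_cases hj : j = i
    · subst hj; simp
    · simp [hj]
  choose v hv using fun j : Fin d => smul_power_eq (d := d) (by omega)
    ((d : ℂ)⁻¹ * (ζ ^ (j : ℕ)) ^ (d - 1)) (x + ζ ^ (j : ℕ) • y)
  exact ⟨v, by rw [hW]; exact Finset.sum_congr rfl fun j _ => hv j⟩

theorem tmul_eq_sum_of_eq_sum {d₁ d₂ m n : ℕ} {S : SymTensor d₁} {T : SymTensor d₂}
    (hS : ∃ v : Fin m → C2, S = ∑ i, power d₁ (v i))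
    (hT : ∃ w : Fin n → C2, T = ∑ i, power d₂ (w i)) :
    ∃ v w : Fin (m * n) → C2,
      S ⊗ₜ[ℂ] T = ∑ i, power d₁ (v i) ⊗ₜ[ℂ] power d₂ (w i) := by
  obtain ⟨v, rfl⟩ := hS
  obtain ⟨w, rfl⟩ := hT
  refine ⟨fun i => v (finProdFinEquiv.symm i).1, fun i => w (finProdFinEquiv.symm i).2, ?_⟩
  rw [TensorProduct.sum_tmul, finProdFinEquiv.symm.sum_comp
    (fun p : Fin m × Fin n => power d₁ (v p.1) ⊗ₜ[ℂ] power d₂ (w p.2)), Fintype.sum_prod_type]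
  simp only [TensorProduct.tmul_sum]

/-! ### Computation of the ranks -/

theorem rank₁_two_eq {q : SymTensor 2} (hq : ∀ v, q ≠ power 2 v)
    (h2 : ∃ v : Fin 2 → C2, q = ∑ i, power 2 (v i)) : rank₁ 2 q = 2 := by
  refine le_antisymm (Nat.sInf_le h2) (le_csInf ⟨2, h2⟩ ?_)
  rintro r ⟨v, hv⟩
  by_contra! hr
  interval_cases r
  -- The empty sum is zero, which is itself a square.
  · obtain ⟨v', hv'⟩ := smul_power_eq (d := 2) (by norm_num) 0 0
    exact hq v' (by rw [hv, ← hv']; simp)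
  · exact hq (v 0) (by rw [hv]; simp)

theorem rank₂_two_eq {d : ℕ} (hd : 2 ≤ d) (b : Module.Basis (Fin 2) ℂ C2)
    {q : SymTensor 2} (hq : ∀ v, q ≠ power 2 v) :
    rank₂ 2 d (q ⊗ₜ[ℂ] W (b 0) (b 1) d) = 2 * d := by
  obtain ⟨u, w, rfl⟩ := exists_eq_W_two b q
  have h := tmul_eq_sum_of_eq_sum (exists_W_eq_sum_power le_rfl u w)
    (exists_W_eq_sum_power hd (b 0) (b 1))
  refine le_antisymm (Nat.sInf_le h) (le_csInf ⟨_, h⟩ ?_)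
  rintro r ⟨v, z, hvz⟩
  exact two_mul_le_of_decomposition hd b (linearIndependent_of_W_two_ne_power hq) v z hvz

/-- A decomposition of `W_d` into r powers gives one of `W_2 ⊗ W_d` into 2r, so 2d ≤ 2r. -/
theorem rank₁_W {d : ℕ} (hd : 2 ≤ d) (b : Module.Basis (Fin 2) ℂ C2) :
    rank₁ d (W (b 0) (b 1) d) = d := by
  have h := exists_W_eq_sum_power hd (b 0) (b 1)
  refine le_antisymm (Nat.sInf_le h) (le_csInf ⟨_, h⟩ ?_)
  rintro r hr
  obtain ⟨v, z, hvz⟩ := tmul_eq_sum_of_eq_sum (exists_W_eq_sum_power le_rfl (b 0) (b 1)) hr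
  have := two_mul_le_of_decomposition hd b
    (linearIndependent_of_W_two_ne_power (W_two_ne_power b)) v z hvz
  omega

theorem exists_equiv_map_W_two (b : Module.Basis (Fin 2) ℂ C2) {q : SymTensor 2}
    (hq : ∀ v, q ≠ power 2 v) : ∃ g : C2 ≃ₗ[ℂ] C2,
      PiTensorProduct.map (fun _ => (g : C2 →ₗ[ℂ] C2)) (W (b 0) (b 1) 2 : ⨂[ℂ]^2 C2) =
        (q : ⨂[ℂ]^2 C2) := by
  obtain ⟨u, w, rfl⟩ := exists_eq_W_two b q
  let c : Module.Basis (Fin 2) ℂ C2 := basisOfLinearIndependentOfCardEqFinrank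
    (linearIndependent_of_W_two_ne_power hq) (by simp)
  have h0 : b.equiv c (Equiv.refl _) (b 0) = u := by simp [c]
  have h1 : b.equiv c (Equiv.refl _) (b 1) = w := by simp [c]
  refine ⟨b.equiv c (Equiv.refl _), ?_⟩
  rw [W_two_coe, W_two_coe, map_add, PiTensorProduct.map_tprod, PiTensorProduct.map_tprod]
  congr 2 <;> (funext i; fin_cases i <;> simp [h0, h1])

end PartSym

theorem mainTheorem7 (d : ℕ) (hd : 2 ≤ d) (b : Module.Basis (Fin 2) ℂ PartSym.C2) :
    -- the rank of `W₂ ⊗ W_d`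
    PartSym.rank₂ 2 d (PartSym.W (b 0) (b 1) 2 ⊗ₜ[ℂ] PartSym.W (b 0) (b 1) d) = 2 * d ∧
    -- it is the product of the ranks `2` and `d` of the two factors
    PartSym.rank₁ 2 (PartSym.W (b 0) (b 1) 2) = 2 ∧
    PartSym.rank₁ d (PartSym.W (b 0) (b 1) d) = d ∧
    PartSym.rank₂ 2 d (PartSym.W (b 0) (b 1) 2 ⊗ₜ[ℂ] PartSym.W (b 0) (b 1) d) =
      PartSym.rank₁ 2 (PartSym.W (b 0) (b 1) 2) * PartSym.rank₁ d (PartSym.W (b 0) (b 1) d) ∧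
    -- every nondegenerate quadratic `q` is equivalent to `W₂`, and may replace it
    (∀ q : PartSym.SymTensor 2, (∀ v : PartSym.C2, q ≠ PartSym.power 2 v) →
      (∃ g : PartSym.C2 ≃ₗ[ℂ] PartSym.C2,
        PiTensorProduct.map (fun _ => (g : PartSym.C2 →ₗ[ℂ] PartSym.C2))
          (PartSym.W (b 0) (b 1) 2 : ⨂[ℂ]^2 PartSym.C2) = (q : ⨂[ℂ]^2 PartSym.C2)) ∧
      PartSym.rank₁ 2 q = 2 ∧
      PartSym.rank₂ 2 d (q ⊗ₜ[ℂ] PartSym.W (b 0) (b 1) d) = 2 * d) ∧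
    -- in particular `x² + y²`
    PartSym.rank₁ 2 (PartSym.power 2 (b 0) + PartSym.power 2 (b 1)) = 2 ∧
    PartSym.rank₂ 2 d
      ((PartSym.power 2 (b 0) + PartSym.power 2 (b 1)) ⊗ₜ[ℂ] PartSym.W (b 0) (b 1) d) = 2 * d := by
  have hW := PartSym.W_two_ne_power b
  have hW2 := PartSym.rank₁_two_eq hW (PartSym.exists_W_eq_sum_power le_rfl _ _)
  have hP := PartSym.power_add_power_ne_power b
  have hT := PartSym.rank₂_two_eq hd b hW
  refine ⟨hT, hW2, PartSym.rank₁_W hd b, ?_, fun q hq => ⟨PartSym.exists_equiv_map_W_two b hq, ?_,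
    PartSym.rank₂_two_eq hd b hq⟩, ?_, PartSym.rank₂_two_eq hd b hP⟩
  · rw [hT, hW2, PartSym.rank₁_W hd b]
  · refine PartSym.rank₁_two_eq hq ?_
    obtain ⟨u, w, rfl⟩ := PartSym.exists_eq_W_two b q
    exact PartSym.exists_W_eq_sum_power le_rfl u w
  · exact PartSym.rank₁_two_eq hP ⟨b, by rw [Fin.sum_univ_two]⟩
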